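/- For a permutation $\pi=\pi_1\pi_2\cdots\pi_n$ of $\{1,\dots,n\}$, let $\mathbf{B}(\pi)$ be the result of one pass of bubblesort: $\pi$ is scanned from left to right and each element is exchanged with its right neighbour whenever the latter is smaller. Let $T_n$ be the rooted tree whose nodes are the permutations of size $n$, whose root is the identity $12\cdots n$, and in which $\tau$ is a child of $\sigma$ if and only if $\mathbf{B}(\tau)=\sigma$ and $\sigma\neq\tau$. The height of a node is the number of edges on the path joining it to the root, and a leaf is a node without children. Let $G_n$ be the average height of a leaf in $T_n$. Then $$G_n = n-\sqrt{\frac{\pi n}{2}}+O(1)\qquad (n\to\infty).$$ Moreover, for every $n\ge 2$: 1. $G_n$ equals the average, over the permutations of size $n$ that are not in the image of $\mathbf{B}$, of the number of passes of bubblesort (the least $k\ge 0$ with $\mathbf{B}^k(\sigma)$ the identity) needed to sort the permutation $\sigma$; 2. $$G_n=(n-1)-\frac{n\,P(n)}{n-1}+\frac{P(n-1)+1}{n-1},$$ where $P(m)=\sum_{k=0}^{m-1}\frac{k!\,k^{m-k}}{m!}$ is the Ramanujan $P$-function. -/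

import Mathlib

open Filter Asymptotics
open scoped Nat

namespace BubbleSort

/-- One comparison of the scan: if the entry at position `i + 1` is smaller than the entry at
position `i`, the two entries are exchanged. A permutation `σ` is the sequence
`σ 0, σ 1, …, σ (n - 1)` (positions and values are numbered from `0`). -/
def step {n : ℕ} (σ : Equiv.Perm (Fin n)) (i : Fin n) : Equiv.Perm (Fin n) :=
  if h : (i : ℕ) + 1 < n then
    if σ ⟨i + 1, h⟩ < σ i then σ * Equiv.swap i ⟨i + 1, h⟩ else σ
  else σ

/-- The bubblesort operator: one pass of bubblesort, scanning the positions from left to right. -/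
def bubble {n : ℕ} (σ : Equiv.Perm (Fin n)) : Equiv.Perm (Fin n) :=
  (List.finRange n).foldl step σ

/-- `τ` is a child of `σ` in `T_n`. -/
def IsChild {n : ℕ} (τ σ : Equiv.Perm (Fin n)) : Prop :=
  bubble τ = σ ∧ σ ≠ τ

/-- The tree `T_n`, as a graph on the permutations of size `n`; its root is the identity `1`, and
its edges join every child to its parent. -/
def tree (n : ℕ) : SimpleGraph (Equiv.Perm (Fin n)) :=
  SimpleGraph.fromRel IsChild

/-- A leaf of `T_n` is a node without children. -/
def IsLeaf {n : ℕ} (σ : Equiv.Perm (Fin n)) : Prop :=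
  ∀ τ, ¬ IsChild τ σ

/-- The height of a node: its distance in `T_n` to the root, that is, the number of edges on the
path that joins it to the root (`T_n` is a tree, see `tree_isTree` below). -/
noncomputable def height {n : ℕ} (σ : Equiv.Perm (Fin n)) : ℕ :=
  (tree n).dist σ 1

/-! Well-definedness: every permutation is sorted by finitely many passes, and `T_n` is a tree. -/

/-- A potential that increases whenever two entries are exchanged. -/
def potential {n : ℕ} (σ : Equiv.Perm (Fin n)) : ℕ := ∑ i : Fin n, (i : ℕ) * (σ i : ℕ)

theorem potential_lt_of_swap {n : ℕ} (σ : Equiv.Perm (Fin n)) (i j : Fin n)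
    (hij : (j : ℕ) = i + 1) (h : σ j < σ i) : potential σ < potential (σ * Equiv.swap i j) := by
  have hne : i ≠ j := by
    intro e
    rw [e] at hij
    omega
  have hj : j ∈ Finset.univ.erase i := by simp [hne.symm]
  unfold potential
  rw [← Finset.add_sum_erase _ _ (Finset.mem_univ i), ← Finset.add_sum_erase _ _ hj,
    ← Finset.add_sum_erase _ (fun x : Fin n => (x : ℕ) * (((σ * Equiv.swap i j) x : Fin n) : ℕ))
      (Finset.mem_univ i),
    ← Finset.add_sum_erase _ (fun x : Fin n => (x : ℕ) * (((σ * Equiv.swap i j) x : Fin n) : ℕ)) hj]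
  have hrest : ∑ x ∈ (Finset.univ.erase i).erase j,
      (x : ℕ) * (((σ * Equiv.swap i j) x : Fin n) : ℕ)
      = ∑ x ∈ (Finset.univ.erase i).erase j, (x : ℕ) * (σ x : ℕ) := by
    refine Finset.sum_congr rfl fun x hx => ?_
    simp only [Finset.mem_erase] at hx
    rw [Equiv.Perm.mul_apply, Equiv.swap_apply_of_ne_of_ne hx.2.1 hx.1]
  rw [hrest]
  simp only [Equiv.Perm.mul_apply, Equiv.swap_apply_left, Equiv.swap_apply_right, hij]
  have h' : (σ j : ℕ) < (σ i : ℕ) := h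
  nlinarith

theorem step_eq_or_lt {n : ℕ} (σ : Equiv.Perm (Fin n)) (i : Fin n) :
    step σ i = σ ∨ potential σ < potential (step σ i) := by
  unfold step
  split_ifs with h h'
  · exact Or.inr (potential_lt_of_swap σ i ⟨i + 1, h⟩ rfl h')
  · exact Or.inl rfl
  · exact Or.inl rfl

theorem foldl_step {n : ℕ} (l : List (Fin n)) : ∀ σ : Equiv.Perm (Fin n),
    (∀ i ∈ l, step σ i = σ) ∧ l.foldl step σ = σ ∨ potential σ < potential (l.foldl step σ) := by
  induction l with
  | nil => intro σ; left; simp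
  | cons a l ih =>
    intro σ
    rw [List.foldl_cons]
    rcases step_eq_or_lt σ a with h | h
    · rw [h]
      rcases ih σ with ⟨h1, h2⟩ | h1
      · left
        refine ⟨?_, h2⟩
        intro i hi
        rcases List.mem_cons.1 hi with rfl | hi
        · exact h
        · exact h1 i hi
      · exact Or.inr h1
    · right
      rcases ih (step σ a) with ⟨-, h2⟩ | h1
      · rw [h2]; exact h
      · exact h.trans h1

theorem eq_one_of_step {n : ℕ} (σ : Equiv.Perm (Fin n)) (h : ∀ i, step σ i = σ) : σ = 1 := by
  have hmono : StrictMono σ := by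
    cases n with
    | zero => intro i; exact i.elim0
    | succ m =>
      rw [Fin.strictMono_iff_lt_succ]
      intro i
      by_contra hlt
      have hlt' : σ i.succ < σ i.castSucc := by
        refine lt_of_le_of_ne (not_lt.1 hlt) fun e => ?_
        exact (Fin.castSucc_lt_succ (i := i)).ne' (σ.injective e)
      have := potential_lt_of_swap σ i.castSucc i.succ (by simp) hlt'
      have hs := h i.castSucc
      unfold step at hs
      have hi : (i.castSucc : ℕ) + 1 < m + 1 := by simp
      have he : (⟨(i.castSucc : ℕ) + 1, hi⟩ : Fin (m + 1)) = i.succ := by ext; simp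
      rw [dif_pos hi, he, if_pos hlt'] at hs
      rw [hs] at this
      exact lt_irrefl _ this
  ext i
  have := congrArg (fun f : Fin n ≃o Fin n => f i)
    (Subsingleton.elim (hmono.orderIsoOfSurjective σ σ.surjective) (OrderIso.refl _))
  simpa using congrArg Fin.val this

theorem potential_lt_bubble {n : ℕ} (σ : Equiv.Perm (Fin n)) (h : σ ≠ 1) :
    potential σ < potential (bubble σ) := by
  rcases foldl_step (List.finRange n) σ with ⟨h1, -⟩ | h1
  · exact absurd (eq_one_of_step σ fun i => h1 i (List.mem_finRange i)) h
  · exact h1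

theorem bubble_one {n : ℕ} : bubble (1 : Equiv.Perm (Fin n)) = 1 := by
  have hs : ∀ i, step (1 : Equiv.Perm (Fin n)) i = 1 := by
    intro i
    unfold step
    split_ifs with h h'
    · simp [Fin.lt_def] at h'
    · rfl
    · rfl
  have : ∀ l : List (Fin n), l.foldl step (1 : Equiv.Perm (Fin n)) = 1 := by
    intro l
    induction l with
    | nil => rfl
    | cons a l ih => rw [List.foldl_cons, hs, ih]
  exact this _

theorem bubble_ne {n : ℕ} {σ : Equiv.Perm (Fin n)} (h : σ ≠ 1) : bubble σ ≠ σ := by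
  intro e
  have := potential_lt_bubble σ h
  rw [e] at this
  exact lt_irrefl _ this

/-- Bubblesort sorts: some number of passes leads to the identity. -/
theorem exists_iterate_bubble {n : ℕ} (σ : Equiv.Perm (Fin n)) : ∃ k, bubble^[k] σ = 1 := by
  by_contra! hne
  have hk : ∀ k, k ≤ potential (bubble^[k] σ) := by
    intro k
    induction k with
    | zero => exact Nat.zero_le _
    | succ k ih =>
      rw [Function.iterate_succ_apply']
      exact lt_of_le_of_lt ih (potential_lt_bubble _ (hne k))
  obtain ⟨M, hM⟩ := (Set.finite_range (potential (n := n))).bddAbove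
  have h1 := hk (M + 1)
  have h2 := hM (Set.mem_range_self (bubble^[M + 1] σ))
  omega

theorem tree_adj_bubble {n : ℕ} {σ : Equiv.Perm (Fin n)} (h : σ ≠ 1) :
    (tree n).Adj σ (bubble σ) := by
  rw [tree, SimpleGraph.fromRel_adj]
  exact ⟨(bubble_ne h).symm, Or.inl ⟨rfl, bubble_ne h⟩⟩

/-- `T_n` is a tree. -/
theorem tree_isTree (n : ℕ) : (tree n).IsTree := by
  rw [SimpleGraph.isTree_iff_connected_and_card]
  constructor
  · have hreach : ∀ (k : ℕ) (σ : Equiv.Perm (Fin n)), bubble^[k] σ = 1 →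
        (tree n).Reachable σ 1 := by
      intro k
      induction k with
      | zero => intro σ h; rw [show σ = 1 from h]
      | succ k ih =>
        intro σ h
        by_cases h1 : σ = 1
        · rw [h1]
        · exact (tree_adj_bubble h1).reachable.trans (ih _ h)
    refine ⟨fun σ τ => ?_⟩
    obtain ⟨k, hk⟩ := exists_iterate_bubble σ
    obtain ⟨m, hm⟩ := exists_iterate_bubble τ
    exact (hreach k σ hk).trans (hreach m τ hm).symm
  · let f : {σ : Equiv.Perm (Fin n) // σ ≠ 1} → (tree n).edgeSet :=
      fun σ => ⟨s(σ.1, bubble σ.1), tree_adj_bubble σ.2⟩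
    have hf : Function.Bijective f := by
      constructor
      · rintro ⟨σ, hσ⟩ ⟨τ, hτ⟩ h
        have h' : s(σ, bubble σ) = s(τ, bubble τ) := congrArg Subtype.val h
        rw [Sym2.eq_iff] at h'
        rcases h' with ⟨h1, -⟩ | ⟨h1, h2⟩
        · exact Subtype.ext h1
        · have a := potential_lt_bubble σ hσ
          have b := potential_lt_bubble τ hτ
          rw [h2] at a
          rw [← h1] at b
          omega
      · rintro ⟨e, he⟩
        induction e using Sym2.ind with
        | _ σ τ =>
          have he' : (tree n).Adj σ τ := he
          rw [tree, SimpleGraph.fromRel_adj] at he'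
          rcases he' with ⟨hne, ⟨h1, -⟩ | ⟨h1, -⟩⟩
          · refine ⟨⟨σ, ?_⟩, Subtype.ext ?_⟩
            · rintro rfl
              exact hne (bubble_one.symm.trans h1)
            · change s(σ, bubble σ) = s(σ, τ)
              rw [h1]
          · refine ⟨⟨τ, ?_⟩, Subtype.ext ?_⟩
            · rintro rfl
              exact hne.symm (bubble_one.symm.trans h1)
            · change s(τ, bubble τ) = s(σ, τ)
              rw [h1, Sym2.eq_swap]
    rw [← Nat.card_congr (Equiv.ofBijective f hf), Nat.card_eq_fintype_card,
      Nat.card_eq_fintype_card, Fintype.card_subtype_compl, Fintype.card_subtype_eq]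
    exact Nat.sub_add_cancel Fintype.card_pos

/-- The number of passes of bubblesort needed to sort `σ`. -/
def passes {n : ℕ} (σ : Equiv.Perm (Fin n)) : ℕ :=
  Nat.find (exists_iterate_bubble σ)

open Classical in
/-- The average height of a leaf in `T_n`. -/
noncomputable def averageLeafHeight (n : ℕ) : ℝ :=
  (∑ σ : Equiv.Perm (Fin n) with IsLeaf σ, (height σ : ℝ)) /
    (Finset.card {σ : Equiv.Perm (Fin n) | IsLeaf σ} : ℝ)

open Classical in
/-- The average number of passes needed to sort a permutation of size `n` that is not in the image
of the bubblesort operator. -/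
noncomputable def averagePassesOffImage (n : ℕ) : ℝ :=
  (∑ σ : Equiv.Perm (Fin n) with σ ∉ Set.range bubble, (passes σ : ℝ)) /
    (Finset.card {σ : Equiv.Perm (Fin n) | σ ∉ Set.range bubble} : ℝ)

/-- The Ramanujan `P`-function. -/
noncomputable def ramanujanP (n : ℕ) : ℝ :=
  ∑ k ∈ Finset.range n, ((k ! : ℝ) * (k : ℝ) ^ (n - k)) / (n ! : ℝ)

end BubbleSort

namespace BubbleSort


/-! One pass carries the running maximum to the right and shifts every other entry one place to the
left. Hence the largest deficit `p - σ p` drops by exactly one per pass until it reaches zero, and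
`passes σ ≤ k` means `p ≤ σ p + k` for all `p` (`passes_le_iff`). Height in the tree is the number
of passes (`height_eq_passes`), and for `n ≥ 2` the leaves are the permutations outside the image,
namely those that do not fix the last position (`mem_range_bubble_iff`).

The deficit condition is counted position by position: `k ! * (k + 1) ^ (n - k)` permutations need
at most `k` passes, and those fixing the last position are counted in the same way. Subtracting and
summing over `k` gives the exact formula in terms of `ramanujanP`.

For the asymptotics, the term of `P(n)` with `n - k = j` is a product close to `exp (-j² / (2n))`,
with total error O(1). The Gaussian sum differs from its integral `√(πn/2)` by O(1), and
substitution in the exact formula finishes the proof. -/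

/-! ### The effect of one pass and the number of passes. -/

theorem eq_one_of_le_apply {n : ℕ} (σ : Equiv.Perm (Fin n)) (h : ∀ p, p ≤ σ p) : σ = 1 := by
  have hs : ∑ p : Fin n, (p : ℕ) = ∑ p : Fin n, (σ p : ℕ) :=
    (Equiv.sum_comp σ (fun p : Fin n => (p : ℕ))).symm
  rw [Finset.sum_eq_sum_iff_of_le (fun p _ => Fin.le_def.1 (h p))] at hs
  ext p
  exact (hs p (Finset.mem_univ p)).symm

theorem eq_of_apply_le {n : ℕ} (σ τ : Equiv.Perm (Fin n)) (h : ∀ p, σ p ≤ τ p) : σ = τ := by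
  have h1 : τ * σ⁻¹ = 1 := eq_one_of_le_apply _ fun p => by
    simpa using h (σ⁻¹ p)
  exact (mul_inv_eq_one.1 h1).symm

/-- Pigeonhole: the `m + 1` distinct values at positions up to `m` all lie in `Iic (σ m)`. -/
theorem le_apply_of_forall_apply_le {n : ℕ} (σ : Equiv.Perm (Fin n)) (m : Fin n)
    (h : ∀ j ≤ m, σ j ≤ σ m) : m ≤ σ m := by
  have h1 : (Finset.Iic m).map σ.toEmbedding ⊆ Finset.Iic (σ m) := by
    intro x hx
    obtain ⟨j, hj, rfl⟩ := Finset.mem_map.1 hx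
    exact Finset.mem_Iic.2 (h j (Finset.mem_Iic.1 hj))
  have h2 := Finset.card_le_card h1
  rw [Finset.card_map, Fin.card_Iic, Fin.card_Iic] at h2
  exact Fin.le_def.2 (by omega)

/-- What a pass over the first positions, up to `m`, has done to the sequence `σ`. -/
theorem foldl_take_step_spec {n : ℕ} (σ : Equiv.Perm (Fin n)) (m : ℕ) (hm : m < n) :
    let τ := ((List.finRange n).take m).foldl step σ
    (∀ j : Fin n, m < j → τ j = σ j) ∧ (∀ j : Fin n, j ≤ ⟨m, hm⟩ → τ j ≤ τ ⟨m, hm⟩) ∧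
    (∀ (j : Fin n) (hj : (j : ℕ) + 1 < n), (j : ℕ) < m →
      τ j ≤ σ ⟨j + 1, hj⟩ ∧ (τ j = σ ⟨j + 1, hj⟩ ∨ j ≤ τ j)) := by
  induction m with
  | zero =>
    refine ⟨fun j _ => rfl, fun j hj => ?_, fun j _ h => absurd h (Nat.not_lt_zero _)⟩
    have : j = ⟨0, hm⟩ := Fin.ext (by simpa [Fin.le_def] using hj)
    rw [this]
  | succ m ih =>
    have hm' : m < n := by omega
    obtain ⟨h1, h2, h3⟩ := ih hm'
    have hfold : ((List.finRange n).take (m + 1)).foldl step σ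
        = step (((List.finRange n).take m).foldl step σ) ⟨m, hm'⟩ := by
      rw [List.take_add_one, List.foldl_append, List.getElem?_eq_getElem (by simpa using hm')]
      simp
    simp only [hfold]
    generalize ((List.finRange n).take m).foldl step σ = τ at *
    -- Position `m` holds the running maximum. If it is not exchanged it stays there for good, and
    -- this bound supplies the second alternative of the last clause.
    have hle := le_apply_of_forall_apply_le τ ⟨m, hm'⟩ h2
    have hnext : τ ⟨m + 1, hm⟩ = σ ⟨m + 1, hm⟩ := h1 _ (by simp)
    by_cases hlt : τ ⟨m + 1, hm⟩ < τ ⟨m, hm'⟩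
    · have hs : step τ ⟨m, hm'⟩ = τ * Equiv.swap ⟨m, hm'⟩ ⟨m + 1, hm⟩ := by
        simp [step, hm, hlt]
      rw [hs]
      have hoth : ∀ j : Fin n, (j : ℕ) ≠ m → (j : ℕ) ≠ m + 1 →
          (τ * Equiv.swap (⟨m, hm'⟩ : Fin n) ⟨m + 1, hm⟩ : Equiv.Perm (Fin n)) j = τ j := by
        intro j ha hb
        rw [Equiv.Perm.mul_apply, Equiv.swap_apply_of_ne_of_ne]
        · exact fun e => ha (congrArg Fin.val e)
        · exact fun e => hb (congrArg Fin.val e)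
      have hl : (τ * Equiv.swap (⟨m, hm'⟩ : Fin n) ⟨m + 1, hm⟩ : Equiv.Perm (Fin n)) ⟨m, hm'⟩ = τ ⟨m + 1, hm⟩ := by simp
      have hr : (τ * Equiv.swap (⟨m, hm'⟩ : Fin n) ⟨m + 1, hm⟩ : Equiv.Perm (Fin n)) ⟨m + 1, hm⟩ = τ ⟨m, hm'⟩ := by simp
      refine ⟨fun j hj => ?_, fun j hj => ?_, fun j hj hjm => ?_⟩
      · rw [hoth j (by omega) (by omega)]
        exact h1 j (by omega)
      · rw [hr]
        rw [Fin.le_def] at hj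
        simp only at hj
        rcases Nat.lt_trichotomy (j : ℕ) m with hj' | hj' | hj'
        · rw [hoth j (by omega) (by omega)]
          exact h2 j (by rw [Fin.le_def]; exact hj'.le)
        · obtain rfl : j = ⟨m, hm'⟩ := Fin.ext hj'
          rw [hl]; exact hlt.le
        · obtain rfl : j = ⟨m + 1, hm⟩ := Fin.ext (by simp only; omega)
          rw [hr]
      · rcases Nat.lt_or_ge (j : ℕ) m with hj' | hj'
        · rw [hoth j (by omega) (by omega)]
          exact h3 j hj hj'
        · obtain rfl : j = ⟨m, hm'⟩ := Fin.ext (by simp only; omega)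
          rw [hl, hnext]
          exact ⟨le_rfl, Or.inl rfl⟩
    · have hs : step τ ⟨m, hm'⟩ = τ := by simp [step, hm, hlt]
      rw [hs]
      rw [not_lt] at hlt
      refine ⟨fun j hj => h1 j (by omega), fun j hj => ?_, fun j hj hjm => ?_⟩
      · rw [Fin.le_def] at hj
        simp only at hj
        rcases Nat.lt_or_ge m (j : ℕ) with hj' | hj'
        · obtain rfl : j = ⟨m + 1, hm⟩ := Fin.ext (by simp only; omega)
          exact le_rfl
        · exact (h2 j (by rw [Fin.le_def]; exact hj')).trans hlt
      · rcases Nat.lt_or_ge (j : ℕ) m with hj' | hj'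
        · exact h3 j hj hj'
        · obtain rfl : j = ⟨m, hm'⟩ := Fin.ext (by simp only; omega)
          exact ⟨hnext ▸ hlt, Or.inr hle⟩

theorem bubble_eq_foldl_take {m : ℕ} (σ : Equiv.Perm (Fin (m + 1))) :
    bubble σ = ((List.finRange (m + 1)).take m).foldl step σ := by
  have h : List.finRange (m + 1) = (List.finRange (m + 1)).take m ++ [Fin.last m] := by
    conv_lhs => rw [← List.take_length (l := List.finRange (m + 1)), List.length_finRange,
      List.take_add_one, List.getElem?_eq_getElem (by simp)]
    simp [Fin.last]
  unfold bubble
  conv_lhs => rw [h, List.foldl_append]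
  simp [step]

theorem bubble_apply_last {m : ℕ} (σ : Equiv.Perm (Fin (m + 1))) :
    bubble σ (Fin.last m) = Fin.last m := by
  rw [bubble_eq_foldl_take]
  have h := (foldl_take_step_spec σ m (Nat.lt_succ_self m)).2.1
  exact le_antisymm (Fin.le_last _) (le_apply_of_forall_apply_le _ (Fin.last m) h)

theorem bubble_castSucc_spec {m : ℕ} (σ : Equiv.Perm (Fin (m + 1))) (j : Fin m) :
    bubble σ j.castSucc ≤ σ j.succ ∧
      (bubble σ j.castSucc = σ j.succ ∨ j.castSucc ≤ bubble σ j.castSucc) := by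
  rw [bubble_eq_foldl_take]
  exact (foldl_take_step_spec σ m (Nat.lt_succ_self m)).2.2 j.castSucc (by simp) j.2

/-- The condition at `j + 1` for `σ` becomes the condition at `j` for `bubble σ`, because that entry
has moved one place left. Where a running maximum stays behind instead, its value is at least its
position and the condition is automatic. -/
theorem forall_le_bubble_add_iff {n : ℕ} (σ : Equiv.Perm (Fin n)) (k : ℕ) :
    (∀ p : Fin n, (p : ℕ) ≤ bubble σ p + k) ↔ ∀ p : Fin n, (p : ℕ) ≤ σ p + (k + 1) := by
  cases n with
  | zero => exact ⟨fun _ p => p.elim0, fun _ p => p.elim0⟩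
  | succ m =>
    constructor
    · intro h p
      cases p using Fin.cases with
      | zero => simp
      | succ j =>
        have h1 := h j.castSucc
        have h2 := Fin.le_def.1 (bubble_castSucc_spec σ j).1
        simp only [Fin.val_castSucc, Fin.val_succ] at *
        omega
    · intro h p
      cases p using Fin.lastCases with
      | last => rw [bubble_apply_last]; simp
      | cast j =>
        have h1 := h j.succ
        rcases (bubble_castSucc_spec σ j).2 with h2 | h2
        · rw [h2]
          simp only [Fin.val_castSucc, Fin.val_succ] at *
          omega
        · exact (Fin.le_def.1 h2).trans (Nat.le_add_right _ _)

theorem iterate_bubble_eq_one_iff {n : ℕ} (k : ℕ) (σ : Equiv.Perm (Fin n)) :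
    bubble^[k] σ = 1 ↔ ∀ p : Fin n, (p : ℕ) ≤ σ p + k := by
  induction k generalizing σ with
  | zero => exact ⟨fun h p => by rw [show σ = 1 from h]; simp, fun h => eq_one_of_le_apply σ h⟩
  | succ k ih => rw [Function.iterate_succ_apply, ih, forall_le_bubble_add_iff]

theorem passes_le_iff {n : ℕ} (σ : Equiv.Perm (Fin n)) (k : ℕ) :
    passes σ ≤ k ↔ ∀ p : Fin n, (p : ℕ) ≤ σ p + k := by
  unfold passes
  rw [Nat.find_le_iff]
  constructor
  · rintro ⟨m, hm, h⟩ p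
    have := (iterate_bubble_eq_one_iff m σ).1 h p
    omega
  · intro h
    exact ⟨k, le_rfl, (iterate_bubble_eq_one_iff k σ).2 h⟩

theorem iterate_bubble_passes {n : ℕ} (σ : Equiv.Perm (Fin n)) : bubble^[passes σ] σ = 1 :=
  Nat.find_spec (exists_iterate_bubble σ)

theorem passes_le_passes_bubble_add_one {n : ℕ} (σ : Equiv.Perm (Fin n)) :
    passes σ ≤ passes (bubble σ) + 1 := by
  rw [passes_le_iff, ← forall_le_bubble_add_iff, ← passes_le_iff]

theorem passes_bubble_le {n : ℕ} (σ : Equiv.Perm (Fin n)) : passes (bubble σ) ≤ passes σ := by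
  rw [passes_le_iff, forall_le_bubble_add_iff, ← passes_le_iff]
  exact Nat.le_succ _

/-! ### Heights and leaves of the tree. -/

theorem height_eq_passes {n : ℕ} (σ : Equiv.Perm (Fin n)) : height σ = passes σ := by
  apply le_antisymm
  · have h : ∀ (k : ℕ) (τ : Equiv.Perm (Fin n)), bubble^[k] τ = 1 → (tree n).dist τ 1 ≤ k := by
      intro k
      induction k with
      | zero => intro τ h; rw [show τ = 1 from h]; simp
      | succ k ih =>
        intro τ h
        by_cases h1 : τ = 1
        · rw [h1]; simp
        · have h2 := (tree_isTree n).1.dist_triangle (u := τ) (v := bubble τ) (w := 1)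
          rw [SimpleGraph.dist_eq_one_iff_adj.2 (tree_adj_bubble h1)] at h2
          have := ih (bubble τ) h
          omega
    exact h _ σ (iterate_bubble_passes σ)
  -- Along an edge, in either direction, `passes` drops by at most one, so no walk to the root is
  -- shorter than `passes σ`.
  · have h : ∀ (τ ρ : Equiv.Perm (Fin n)) (w : (tree n).Walk τ ρ),
        passes τ ≤ passes ρ + w.length := by
      intro τ ρ w
      induction w with
      | nil => simp
      | cons hadj w ih =>
        rw [SimpleGraph.Walk.length_cons]
        rw [tree, SimpleGraph.fromRel_adj] at hadj
        rcases hadj with ⟨-, ⟨h, -⟩ | ⟨h, -⟩⟩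
        · rename_i u v _
          have := passes_le_passes_bubble_add_one u
          rw [h] at this
          omega
        · rename_i u v _
          have := passes_bubble_le v
          rw [h] at this
          omega
    obtain ⟨w, hw⟩ := ((tree_isTree n).1.preconnected σ 1).exists_walk_length_eq_dist
    have h1 := h σ 1 w
    have h2 : passes (1 : Equiv.Perm (Fin n)) = 0 :=
      Nat.le_zero.1 ((passes_le_iff 1 0).2 fun p => by simp)
    rw [hw, h2, zero_add] at h1
    exact h1

/-- The rotation puts the maximum in front, and one pass carries it back to the end. A pointwise
upper bound suffices by `eq_of_apply_le`. -/
theorem bubble_mul_inv_finRotate {m : ℕ} (σ : Equiv.Perm (Fin (m + 1)))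
    (h : σ (Fin.last m) = Fin.last m) : bubble (σ * (finRotate (m + 1))⁻¹) = σ := by
  apply eq_of_apply_le
  intro p
  cases p using Fin.lastCases with
  | last => rw [h]; exact Fin.le_last _
  | cast j =>
    refine (bubble_castSucc_spec _ j).1.trans (le_of_eq ?_)
    rw [Equiv.Perm.mul_apply]
    congr 1
    rw [Equiv.Perm.inv_eq_iff_eq]
    simp

theorem mem_range_bubble_iff {m : ℕ} (σ : Equiv.Perm (Fin (m + 1))) :
    σ ∈ Set.range bubble ↔ σ (Fin.last m) = Fin.last m := by
  constructor
  · rintro ⟨τ, rfl⟩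
    exact bubble_apply_last τ
  · exact fun h => ⟨_, bubble_mul_inv_finRotate σ h⟩

theorem isLeaf_iff {n : ℕ} (hn : 2 ≤ n) (σ : Equiv.Perm (Fin n)) :
    IsLeaf σ ↔ σ ∉ Set.range bubble := by
  obtain ⟨m, rfl⟩ : ∃ m, n = m + 1 := ⟨n - 1, by omega⟩
  constructor
  · intro h hmem
    rw [mem_range_bubble_iff] at hmem
    refine h (σ * (finRotate (m + 1))⁻¹) ⟨bubble_mul_inv_finRotate σ hmem, fun e => ?_⟩
    -- The preimage is a genuine child because the rotation is nontrivial. For size 1 this fails: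
    -- the identity is a leaf although it lies in the image.
    have h1 : finRotate (m + 1) = 1 := inv_eq_one.1 (left_eq_mul.1 e)
    have h2 := congrArg (fun f : Equiv.Perm (Fin (m + 1)) => f (Fin.last m)) h1
    simp only [finRotate_last, Equiv.Perm.coe_one, id] at h2
    have := congrArg Fin.val h2
    simp at this
    omega
  · rintro h τ ⟨h1, -⟩
    exact h ⟨τ, h1⟩

theorem averageLeafHeight_eq_averagePassesOffImage {n : ℕ} (hn : 2 ≤ n) :
    averageLeafHeight n = averagePassesOffImage n := by
  unfold averageLeafHeight averagePassesOffImage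
  simp only [isLeaf_iff hn, height_eq_passes]


/-! ### Counting permutations by number of passes. -/

/-- Among the later positions, the swap of `0` and `q` alters only the one with value `q`, which
becomes `0`. The bound lost there already follows from `q ≤ k`. -/
theorem decomposeFin_symm_apply_le_add_iff {n : ℕ} (k : ℕ) (q : Fin (n + 1))
    (e : Equiv.Perm (Fin n)) :
    (∀ p : Fin (n + 1), (Equiv.Perm.decomposeFin.symm (q, e) p : ℕ) ≤ p + k) ↔
      (q : ℕ) ≤ k ∧ ∀ p : Fin n, (e p : ℕ) ≤ p + k := by
  rw [Fin.forall_fin_succ]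
  simp only [Equiv.Perm.decomposeFin_symm_apply_zero, Equiv.Perm.decomposeFin_symm_apply_succ,
    Fin.val_zero, zero_add, Fin.val_succ]
  refine and_congr_right fun hq => forall_congr' fun p => ?_
  by_cases h : (e p).succ = q
  · rw [h, Equiv.swap_apply_right]
    have := congrArg Fin.val h
    simp only [Fin.val_succ] at this
    constructor
    · intro; omega
    · intro; simp
  · rw [Equiv.swap_apply_of_ne_of_ne (Fin.succ_ne_zero _) h, Fin.val_succ]
    omega

theorem card_filter_val_le (n k : ℕ) :
    Finset.card {q : Fin (n + 1) | (q : ℕ) ≤ k} = min (k + 1) (n + 1) := by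
  rw [min_comm, ← Fin.card_filter_val_lt]
  simp only [Nat.lt_succ_iff]

theorem card_apply_le_add (n k : ℕ) :
    Finset.card {π : Equiv.Perm (Fin n) | ∀ p, (π p : ℕ) ≤ p + k} =
      ∏ i ∈ Finset.range n, min (k + 1) (i + 1) := by
  induction n with
  | zero => rfl
  | succ n ih =>
    rw [Finset.prod_range_succ, ← ih, mul_comm, ← card_filter_val_le n k, ← Finset.card_product]
    refine Finset.card_equiv Equiv.Perm.decomposeFin fun π => ?_
    obtain ⟨⟨q, e⟩, rfl⟩ := Equiv.Perm.decomposeFin.symm.surjective π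
    simp [decomposeFin_symm_apply_le_add_iff]

theorem card_apply_le_add_apply_zero (n k : ℕ) :
    Finset.card {π : Equiv.Perm (Fin (n + 1)) | (∀ p, (π p : ℕ) ≤ p + k) ∧ π 0 = 0} =
      ∏ i ∈ Finset.range n, min (k + 1) (i + 1) := by
  have h : ∀ s : Finset (Equiv.Perm (Fin n)), s.card = (({0} : Finset (Fin (n + 1))) ×ˢ s).card :=
    fun s => by rw [Finset.card_product, Finset.card_singleton, one_mul]
  rw [← card_apply_le_add, h]
  refine Finset.card_equiv Equiv.Perm.decomposeFin fun π => ?_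
  obtain ⟨⟨q, e⟩, rfl⟩ := Equiv.Perm.decomposeFin.symm.surjective π
  simp only [Finset.mem_filter, Finset.mem_univ, true_and, decomposeFin_symm_apply_le_add_iff,
    Equiv.Perm.decomposeFin_symm_apply_zero, Equiv.apply_symm_apply, Finset.mem_product,
    Finset.mem_singleton]
  constructor
  · rintro ⟨⟨-, h1⟩, h2⟩
    exact ⟨h2, h1⟩
  · rintro ⟨rfl, h1⟩
    exact ⟨⟨by simp, h1⟩, rfl⟩

theorem prod_range_min_eq {n k : ℕ} (h : k ≤ n) :
    ∏ i ∈ Finset.range n, min (k + 1) (i + 1) = k ! * (k + 1) ^ (n - k) := by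
  induction n, h using Nat.le_induction with
  | base =>
    rw [Nat.sub_self, pow_zero, mul_one, ← Finset.prod_range_add_one_eq_factorial]
    refine Finset.prod_congr rfl fun i hi => ?_
    have := Finset.mem_range.1 hi
    omega
  | succ n h ih =>
    rw [Finset.prod_range_succ, ih, Nat.succ_sub h, pow_succ, Nat.min_eq_left (by omega), mul_assoc]

/-- Reversing positions and values turns deficits into excesses, the form that the recursion on
position `0` counts. -/
theorem le_apply_add_iff_rev {n k : ℕ} (σ : Equiv.Perm (Fin n)) :
    (∀ p, (Fin.revPerm.permCongr σ p : ℕ) ≤ p + k) ↔ ∀ p : Fin n, (p : ℕ) ≤ σ p + k := by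
  rw [← Fin.revPerm.forall_congr_right]
  refine forall_congr' fun p => ?_
  have h1 := p.2
  have h2 := (σ p).2
  simp only [Equiv.permCongr_apply, Fin.revPerm_symm, Fin.revPerm_apply, Fin.rev_rev, Fin.val_rev]
  omega

theorem card_passes_le {n k : ℕ} (h : k ≤ n) :
    Finset.card {σ : Equiv.Perm (Fin n) | passes σ ≤ k} = k ! * (k + 1) ^ (n - k) := by
  rw [← prod_range_min_eq h, ← card_apply_le_add]
  refine Finset.card_equiv Fin.revPerm.permCongr fun σ => ?_
  simp only [Finset.mem_filter, Finset.mem_univ, true_and, passes_le_iff, le_apply_add_iff_rev]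

theorem card_passes_le_apply_last {m k : ℕ} (h : k ≤ m) :
    Finset.card {σ : Equiv.Perm (Fin (m + 1)) | passes σ ≤ k ∧ σ (Fin.last m) = Fin.last m} =
      k ! * (k + 1) ^ (m - k) := by
  rw [← prod_range_min_eq h, ← card_apply_le_add_apply_zero]
  refine Finset.card_equiv Fin.revPerm.permCongr fun σ => ?_
  simp only [Finset.mem_filter, Finset.mem_univ, true_and, passes_le_iff, le_apply_add_iff_rev]
  refine and_congr_right fun _ => ?_
  simp [Fin.rev_eq_iff]

theorem card_passes_le_apply_last_ne {m k : ℕ} (h : k ≤ m) :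
    Finset.card {σ : Equiv.Perm (Fin (m + 1)) | passes σ ≤ k ∧ σ (Fin.last m) ≠ Fin.last m} =
      k * (k ! * (k + 1) ^ (m - k)) := by
  have h1 := Finset.card_filter_add_card_filter_not
    (s := ({σ | passes σ ≤ k} : Finset (Equiv.Perm (Fin (m + 1)))))
    (fun σ => σ (Fin.last m) = Fin.last m)
  rw [Finset.filter_filter, Finset.filter_filter, card_passes_le_apply_last h,
    card_passes_le (h.trans (Nat.le_succ m)), Nat.succ_sub h, pow_succ] at h1
  refine Nat.add_left_cancel (h1.trans ?_)
  ring

theorem passes_le_of_le {m : ℕ} (σ : Equiv.Perm (Fin (m + 1))) : passes σ ≤ m :=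
  (passes_le_iff σ m).2 fun p => by omega

theorem card_apply_last_ne (m : ℕ) :
    Finset.card {σ : Equiv.Perm (Fin (m + 1)) | σ (Fin.last m) ≠ Fin.last m} = m * m ! := by
  have := card_passes_le_apply_last_ne (le_refl m)
  simpa [passes_le_of_le] using this

/-! ### The exact formula. -/

theorem passes_eq_sum {m : ℕ} (σ : Equiv.Perm (Fin (m + 1))) :
    (passes σ : ℝ) = m - ∑ k ∈ Finset.range m, if passes σ ≤ k then (1 : ℝ) else 0 := by
  have h := passes_le_of_le σ
  rw [← Finset.sum_filter, Finset.sum_const, nsmul_one]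
  have h1 : Finset.filter (fun k => passes σ ≤ k) (Finset.range m) = Finset.Ico (passes σ) m := by
    ext k
    simp [and_comm]
  rw [h1, Nat.card_Ico, Nat.cast_sub h]
  ring

theorem sum_passes_apply_last_ne (m : ℕ) :
    ∑ σ : Equiv.Perm (Fin (m + 1)) with σ (Fin.last m) ≠ Fin.last m, (passes σ : ℝ) =
      m * (m * m !) - ∑ k ∈ Finset.range m, (k : ℝ) * (k ! * ((k : ℝ) + 1) ^ (m - k)) := by
  simp only [passes_eq_sum]
  rw [Finset.sum_sub_distrib, Finset.sum_const, card_apply_last_ne, Finset.sum_comm]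
  congr 1
  · rw [nsmul_eq_mul]; push_cast; ring
  · refine Finset.sum_congr rfl fun k hk => ?_
    rw [← Finset.sum_filter, Finset.sum_const, nsmul_one, Finset.filter_filter]
    have h := card_passes_le_apply_last_ne (Finset.mem_range.1 hk).le
    simp only [and_comm] at h ⊢
    rw [h]
    push_cast
    ring

/-- Write `k * k ! = (k + 1)! - k !` and shift the index in both sums. The `1` added to `ramanujanP
m` is the term `k = m`. -/
theorem sum_mul_factorial_mul_pow_eq {m : ℕ} (hm : m ≠ 0) :
    ∑ k ∈ Finset.range m, (k : ℝ) * (k ! * ((k : ℝ) + 1) ^ (m - k)) =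
      (m + 1)! * ramanujanP (m + 1) - m ! * (ramanujanP m + 1) := by
  have h1 : ((m + 1)! : ℝ) * ramanujanP (m + 1) =
      ∑ k ∈ Finset.range m, ((k + 1)! : ℝ) * ((k : ℝ) + 1) ^ (m - k) := by
    have : ((m + 1)! : ℝ) ≠ 0 := by positivity
    rw [ramanujanP, ← Finset.sum_div, mul_div_cancel₀ _ this, Finset.sum_range_succ']
    simp
  have h2 : (m ! : ℝ) * (ramanujanP m + 1) =
      ∑ k ∈ Finset.range m, (k ! : ℝ) * ((k : ℝ) + 1) ^ (m - k) := by
    have : (m ! : ℝ) ≠ 0 := by positivity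
    rw [mul_add, mul_one, ramanujanP, ← Finset.sum_div, mul_div_cancel₀ _ this]
    have h3 := Finset.sum_range_succ (fun k : ℕ => (k ! : ℝ) * (k : ℝ) ^ (m - k)) m
    have h4 := Finset.sum_range_succ' (fun k : ℕ => (k ! : ℝ) * (k : ℝ) ^ (m - k)) m
    rw [Nat.sub_self, pow_zero, mul_one] at h3
    rw [← h3, h4, Nat.cast_zero, Nat.sub_zero, zero_pow hm, mul_zero, add_zero]
    refine Finset.sum_congr rfl fun k hk => ?_
    have hk' := Finset.mem_range.1 hk
    obtain ⟨d, rfl⟩ : ∃ d, m = k + 1 + d := ⟨m - (k + 1), by omega⟩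
    rw [show k + 1 + d - (k + 1) = d by omega, show k + 1 + d - k = d + 1 by omega,
      Nat.factorial_succ]
    push_cast
    ring
  rw [h1, h2, ← Finset.sum_sub_distrib]
  refine Finset.sum_congr rfl fun k _ => ?_
  rw [Nat.factorial_succ]
  push_cast
  ring

theorem averagePassesOffImage_eq {n : ℕ} (hn : 2 ≤ n) :
    averagePassesOffImage n =
      ((n : ℝ) - 1) - (n : ℝ) * ramanujanP n / ((n : ℝ) - 1)
        + (ramanujanP (n - 1) + 1) / ((n : ℝ) - 1) := by
  obtain ⟨m, rfl⟩ : ∃ m, n = m + 1 := ⟨n - 1, by omega⟩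
  have hm : (m : ℝ) ≠ 0 := by
    have : m ≠ 0 := by omega
    exact_mod_cast this
  have hf : (m ! : ℝ) ≠ 0 := by positivity
  unfold averagePassesOffImage
  simp only [mem_range_bubble_iff]
  have h1 := sum_passes_apply_last_ne m
  have h2 := card_apply_last_ne m
  simp only [ne_eq] at h1 h2
  rw [sum_mul_factorial_mul_pow_eq (by omega), Nat.factorial_succ] at h1
  have h3 : ∀ a b c d : ℝ, a = b → c = d → a / c = b / d := by
    rintro a b c d rfl rfl
    rfl
  refine (h3 _ _ _ _ (by convert h1) (by convert congrArg (Nat.cast (R := ℝ)) h2)).trans ?_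
  push_cast
  rw [add_sub_cancel_right]
  field_simp
  ring


/-! ### Asymptotics of the Ramanujan P-function. -/

theorem prod_range_div_eq (k j : ℕ) :
    ∏ i ∈ Finset.range j, ((k : ℝ) / (k + (i + 1))) =
      ((k ! : ℝ) * (k : ℝ) ^ j) / ((k + j)! : ℝ) := by
  induction j with
  | zero => simp [Nat.factorial_ne_zero]
  | succ j ih =>
    rw [Finset.prod_range_succ, ih, ← Nat.add_assoc, Nat.factorial_succ]
    have h : ((k + j)! : ℝ) ≠ 0 := by positivity
    have h' : (k : ℝ) + (j + 1) ≠ 0 := by positivity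
    push_cast
    rw [show (k : ℝ) + j + 1 = k + (j + 1) by ring]
    field_simp
    ring

theorem sum_range_add_one_div (j : ℕ) (c : ℝ) :
    ∑ i ∈ Finset.range j, (-(((i : ℝ) + 1) / c)) = -((j : ℝ) * (j + 1) / (2 * c)) := by
  have h : ∑ i ∈ Finset.range j, ((i : ℝ) + 1) = (j : ℝ) * (j + 1) / 2 := by
    induction j with
    | zero => simp
    | succ j ih => rw [Finset.sum_range_succ, ih]; push_cast; ring
  rw [Finset.sum_neg_distrib, ← Finset.sum_div, h, div_div]

/-- Each factor is `1 - (i + 1) / (k + i + 1)`, and `1 - x ≤ exp (-x)`. Enlarging the denominators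
to `k + j` makes the exponents summable in closed form. -/
theorem factorial_mul_pow_div_le (k j : ℕ) :
    ((k ! : ℝ) * (k : ℝ) ^ j) / ((k + j)! : ℝ) ≤
      Real.exp (-((j : ℝ) ^ 2 / (2 * ((k + j : ℕ) : ℝ)))) := by
  rw [← prod_range_div_eq]
  have h1 : ∏ i ∈ Finset.range j, ((k : ℝ) / (k + (i + 1))) ≤
      ∏ i ∈ Finset.range j, Real.exp (-(((i : ℝ) + 1) / ((k + j : ℕ) : ℝ))) := by
    refine Finset.prod_le_prod (fun i _ => by positivity) fun i hi => ?_
    have hi' : (i : ℝ) + 1 ≤ j := by exact_mod_cast Finset.mem_range.1 hi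
    have hpos : (0 : ℝ) < k + (i + 1) := by positivity
    have h2 := Real.add_one_le_exp (-(((i : ℝ) + 1) / (k + (i + 1))))
    have h3 : (k : ℝ) / (k + (i + 1)) = -(((i : ℝ) + 1) / (k + (i + 1))) + 1 := by
      field_simp
      ring
    rw [h3]
    refine h2.trans (Real.exp_le_exp.2 (neg_le_neg ?_))
    push_cast
    gcongr
  refine h1.trans ?_
  rw [← Real.exp_sum, sum_range_add_one_div]
  refine Real.exp_le_exp.2 (neg_le_neg ?_)
  gcongr
  nlinarith [(Nat.cast_nonneg j : (0 : ℝ) ≤ j)]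

theorem exp_le_factorial_mul_pow_div {k : ℕ} (hk : 0 < k) (j : ℕ) :
    Real.exp (-((j : ℝ) * (j + 1) / (2 * k))) ≤
      ((k ! : ℝ) * (k : ℝ) ^ j) / ((k + j)! : ℝ) := by
  rw [← prod_range_div_eq, ← sum_range_add_one_div, Real.exp_sum]
  refine Finset.prod_le_prod (fun i _ => (Real.exp_pos _).le) fun i _ => ?_
  have hk' : (0 : ℝ) < k := by exact_mod_cast hk
  rw [Real.exp_neg]
  have h2 := Real.add_one_le_exp (((i : ℝ) + 1) / k)
  have h3 : (k : ℝ) / (k + (i + 1)) = (((i : ℝ) + 1) / k + 1)⁻¹ := by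
    field_simp
    ring
  rw [h3]
  gcongr

/-- The terms of the Ramanujan `P`-function are close to those of a Gaussian sum. -/
theorem exp_sub_factorial_mul_pow_div_le (k j : ℕ) (hj : 0 < j) :
    Real.exp (-((j : ℝ) ^ 2 / (2 * ((k + j : ℕ) : ℝ)))) -
        ((k ! : ℝ) * (k : ℝ) ^ j) / ((k + j)! : ℝ) ≤
      8 * ((j : ℝ) / ((k + j : ℕ) : ℝ)) *
        Real.exp (-((j : ℝ) ^ 2 / (4 * ((k + j : ℕ) : ℝ)))) := by
  have hj0 : (1 : ℝ) ≤ j := by exact_mod_cast hj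
  have hk0 : (0 : ℝ) ≤ k := Nat.cast_nonneg k
  set y : ℝ := (j : ℝ) ^ 2 / (4 * ((k + j : ℕ) : ℝ)) with hy
  have hn : (0 : ℝ) < ((k + j : ℕ) : ℝ) := by exact_mod_cast (by omega : 0 < k + j)
  have hy0 : 0 ≤ y := by positivity
  have hyy : (j : ℝ) ^ 2 / (2 * ((k + j : ℕ) : ℝ)) = 2 * y := by rw [hy]; ring
  rw [hyy]
  set a : ℝ := (j : ℝ) / ((k + j : ℕ) : ℝ) with ha
  have ha0 : 0 ≤ a := by positivity
  have hexp : Real.exp (-(2 * y)) = Real.exp (-y) * Real.exp (-y) := by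
    rw [← Real.exp_add]; ring_nf
  have hle1 : Real.exp (-y) ≤ 1 := Real.exp_le_one_iff.2 (by linarith)
  have hpos := Real.exp_pos (-y)
  -- For `k < j` the ratio `a` exceeds 1/2, so the right side already dominates the exponential.
  rcases Nat.lt_or_ge k j with hkj | hkj
  · have h1 : 0 ≤ ((k ! : ℝ) * (k : ℝ) ^ j) / ((k + j)! : ℝ) := by positivity
    have h2 : 1 ≤ 8 * a := by
      rw [ha, ← mul_div_assoc, le_div_iff₀ hn]
      have : (k : ℝ) ≤ j := by exact_mod_cast hkj.le
      push_cast
      linarith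
    rw [hexp]
    nlinarith
  · have hk : 0 < k := by omega
    have hkj' : (j : ℝ) ≤ k := by exact_mod_cast hkj
    have hkpos : (0 : ℝ) < k := by linarith
    have h1 := exp_le_factorial_mul_pow_div hk j
    -- The error is at most `exp (-2y) * (1 - exp (-d)) ≤ exp (-2y) * d`. Half of the Gaussian decay
    -- is spent on the factor `1 + y` in the bound for `d`.
    set d : ℝ := (j : ℝ) * (j + 1) / (2 * k) - 2 * y with hd
    have hd1 : d ≤ a * (1 + 4 * y) := by
      have : a * (1 + 4 * y) - d =
          ((k : ℝ) - j) * ((k + j) * j + j ^ 3) / (2 * k * (k + j) ^ 2) := by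
        rw [hd, ha, hy]
        push_cast
        field_simp
        ring
      have h4 : 0 ≤ ((k : ℝ) - j) * ((k + j) * j + j ^ 3) / (2 * k * (k + j) ^ 2) := by
        apply div_nonneg _ (by positivity)
        apply mul_nonneg (by linarith) (by positivity)
      linarith
    have h2 : Real.exp (-((j : ℝ) * (j + 1) / (2 * k)))
        = Real.exp (-(2 * y)) * Real.exp (-d) := by
      rw [← Real.exp_add, hd]; ring_nf
    have h3 := Real.add_one_le_exp (-d)
    have h5 : (1 + y) * Real.exp (-y) ≤ 1 := by
      have := Real.add_one_le_exp y
      calc (1 + y) * Real.exp (-y) ≤ Real.exp y * Real.exp (-y) := by gcongr; linarith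
        _ = 1 := by rw [← Real.exp_add]; simp
    have h6 : 0 < Real.exp (-(2 * y)) := Real.exp_pos _
    calc Real.exp (-(2 * y)) - ((k ! : ℝ) * (k : ℝ) ^ j) / ((k + j)! : ℝ)
        ≤ Real.exp (-(2 * y)) * d := by rw [h2] at h1; nlinarith
      _ ≤ Real.exp (-(2 * y)) * (8 * a * (1 + y)) := by
          gcongr
          nlinarith [mul_nonneg ha0 hy0]
      _ = 8 * a * Real.exp (-y) * ((1 + y) * Real.exp (-y)) := by rw [hexp]; ring
      _ ≤ 8 * a * Real.exp (-y) * 1 := by gcongr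
      _ = _ := mul_one _

/-- Each summand is at most eight times a decrement of `exp (-i² / (4n))`, so the sum telescopes to
a bound independent of `n`. -/
theorem sum_div_mul_exp_le (n : ℕ) :
    ∑ i ∈ Finset.range n, (((i + 1 : ℕ) : ℝ) / n) * Real.exp (-(((i + 1 : ℕ) : ℝ) ^ 2 / (4 * n)))
      ≤ 8 := by
  set F : ℕ → ℝ := fun i => Real.exp (-((i : ℝ) ^ 2 / (4 * n))) with hF
  have h : ∀ i ∈ Finset.range n, (((i + 1 : ℕ) : ℝ) / n) * F (i + 1) ≤ 8 * (F i - F (i + 1)) := by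
    intro i hi
    have hin : (i : ℝ) + 1 ≤ n := by exact_mod_cast Finset.mem_range.1 hi
    have hi0 : (0 : ℝ) ≤ i := Nat.cast_nonneg i
    have hn : (0 : ℝ) < n := by linarith
    have h1 : F i = F (i + 1) * Real.exp ((2 * i + 1) / (4 * n)) := by
      simp only [hF]
      rw [← Real.exp_add]
      congr 1
      push_cast
      field_simp
      ring
    have h2 := Real.add_one_le_exp (((2 : ℝ) * i + 1) / (4 * n))
    have h3 : 0 < F (i + 1) := Real.exp_pos _
    have h4 : (((i + 1 : ℕ) : ℝ) / n) ≤ 8 * ((2 * i + 1) / (4 * n)) := by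
      rw [← sub_nonneg]
      have : 8 * ((2 * (i : ℝ) + 1) / (4 * n)) - ((i + 1 : ℕ) : ℝ) / n = (3 * i + 1) / n := by
        push_cast
        field_simp
        ring
      rw [this]
      positivity
    rw [h1]
    nlinarith
  calc _ ≤ ∑ i ∈ Finset.range n, 8 * (F i - F (i + 1)) := Finset.sum_le_sum h
    _ = 8 * (F 0 - F n) := by rw [← Finset.mul_sum, Finset.sum_range_sub']
    _ ≤ 8 := by
      have h1 : F 0 = 1 := by simp [hF]
      have h2 : 0 < F n := Real.exp_pos _
      rw [h1]; linarith

theorem ramanujanP_eq_sum (n : ℕ) :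
    ramanujanP n = ∑ i ∈ Finset.range n,
      (((n - (i + 1))! : ℝ) * ((n - (i + 1) : ℕ) : ℝ) ^ (i + 1)) / (n ! : ℝ) := by
  unfold ramanujanP
  rw [← Finset.sum_range_reflect]
  refine Finset.sum_congr rfl fun i hi => ?_
  have := Finset.mem_range.1 hi
  rw [show n - 1 - i = n - (i + 1) by omega, show n - (n - (i + 1)) = i + 1 by omega]

theorem abs_ramanujanP_sub_sum_le (n : ℕ) :
    |ramanujanP n - ∑ i ∈ Finset.range n, Real.exp (-(((i + 1 : ℕ) : ℝ) ^ 2 / (2 * n)))| ≤ 64 := by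
  rw [ramanujanP_eq_sum, abs_sub_comm, ← Finset.sum_sub_distrib]
  have hkey : ∀ i ∈ Finset.range n, n - (i + 1) + (i + 1) = n := fun i hi => by
    have := Finset.mem_range.1 hi
    omega
  rw [abs_of_nonneg]
  · calc _ ≤ ∑ i ∈ Finset.range n, 8 * ((((i + 1 : ℕ) : ℝ) / n) *
          Real.exp (-(((i + 1 : ℕ) : ℝ) ^ 2 / (4 * n)))) := by
          refine Finset.sum_le_sum fun i hi => ?_
          have := exp_sub_factorial_mul_pow_div_le (n - (i + 1)) (i + 1) (Nat.succ_pos i)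
          rwa [hkey i hi, mul_assoc] at this
      _ ≤ 64 := by
          rw [← Finset.mul_sum]
          linarith [sum_div_mul_exp_le n]
  · refine Finset.sum_nonneg fun i hi => sub_nonneg.2 ?_
    have := factorial_mul_pow_div_le (n - (i + 1)) (i + 1)
    rwa [hkey i hi] at this

theorem abs_sum_exp_sub_sqrt_le {n : ℕ} (hn : 0 < n) :
    |∑ i ∈ Finset.range n, Real.exp (-(((i + 1 : ℕ) : ℝ) ^ 2 / (2 * n))) - √(Real.pi * n / 2)|
      ≤ 3 := by
  have hn0 : (0 : ℝ) < n := by exact_mod_cast hn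
  set f : ℝ → ℝ := fun x => Real.exp (-(1 / (2 * n)) * x ^ 2) with hf
  have hfe : ∀ x : ℝ, f x = Real.exp (-(x ^ 2 / (2 * n))) := fun x => by
    simp only [hf]; congr 1; ring
  have hanti : AntitoneOn f (Set.Icc ((0 : ℕ) : ℝ) (n : ℕ)) := by
    intro x hx y _ hxy
    have hx0 : 0 ≤ x := by simpa using hx.1
    rw [hfe, hfe]
    gcongr
  have h1 := hanti.sum_le_integral_Ico (Nat.zero_le n)
  have h2 := hanti.integral_le_sum_Ico (Nat.zero_le n)
  rw [← Finset.range_eq_Ico] at h1 h2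
  have h3 : ∑ i ∈ Finset.range n, f (i : ℕ) = ∑ i ∈ Finset.range n, f ((i + 1 : ℕ) : ℝ) + f 0 - f n := by
    have e1 := Finset.sum_range_succ (fun i : ℕ => f (i : ℝ)) n
    have e2 := Finset.sum_range_succ' (fun i : ℕ => f (i : ℝ)) n
    simp only [Nat.cast_zero] at e2
    linarith
  have hb : (0 : ℝ) < 1 / (2 * n) := by positivity
  have hint : MeasureTheory.Integrable f := integrable_exp_neg_mul_sq hb
  have hgauss : ∫ x in Set.Ioi (0 : ℝ), f x = √(Real.pi * n / 2) := by
    rw [hf, integral_gaussian_Ioi]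
    rw [show Real.pi / (1 / (2 * (n : ℝ))) = 2 ^ 2 * (Real.pi * n / 2) by
        field_simp,
      Real.sqrt_mul (by positivity), Real.sqrt_sq (by norm_num)]
    ring
  have hsplit := intervalIntegral.integral_Ioi_sub_Ioi (f := f) (μ := MeasureTheory.volume)
    (hint.integrableOn (s := Set.Ioi (0 : ℝ))) hn0.le
  have htail0 : 0 ≤ ∫ x in Set.Ioi (n : ℝ), f x :=
    MeasureTheory.integral_nonneg fun x => (Real.exp_pos _).le
  -- Beyond `n` one has `x² / (2n) ≥ x / 2`. The final 3 is this 2 plus `f 0 = 1` from comparing sum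
  -- and integral.
  have htail : ∫ x in Set.Ioi (n : ℝ), f x ≤ 2 := by
    have hle : ∫ x in Set.Ioi (n : ℝ), f x ≤ ∫ x in Set.Ioi (n : ℝ), Real.exp ((-(1 / 2)) * x) := by
      refine MeasureTheory.setIntegral_mono_on hint.integrableOn
        (integrableOn_exp_mul_Ioi (by norm_num) _) measurableSet_Ioi fun x hx => ?_
      have hx' : (n : ℝ) < x := hx
      rw [hfe]
      refine Real.exp_le_exp.2 ?_
      rw [neg_mul, neg_le_neg_iff, le_div_iff₀ (by positivity)]
      nlinarith
    rw [integral_exp_mul_Ioi (by norm_num)] at hle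
    have : Real.exp (-(1 / 2) * n) ≤ 1 := Real.exp_le_one_iff.2 (by nlinarith)
    linarith
  have hf0 : f 0 = 1 := by simp [hf]
  have hfn : 0 < f n := Real.exp_pos _
  simp only [← hfe]
  simp only [Nat.cast_zero] at h1 h2
  rw [abs_le]
  constructor <;> linarith

theorem abs_ramanujanP_sub_sqrt_le {n : ℕ} (hn : 0 < n) :
    |ramanujanP n - √(Real.pi * n / 2)| ≤ 67 := by
  have h1 := abs_le.1 (abs_ramanujanP_sub_sum_le n)
  have h2 := abs_le.1 (abs_sum_exp_sub_sqrt_le hn)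
  exact abs_le.2 ⟨by linarith [h1.1, h2.1], by linarith [h1.2, h2.2]⟩

theorem sqrt_pi_mul_div_two_le (n : ℕ) : √(Real.pi * n / 2) ≤ 2 * n := by
  rw [Real.sqrt_le_left (by positivity)]
  rcases Nat.eq_zero_or_pos n with rfl | h
  · simp
  · have h1 : (1 : ℝ) ≤ n := by exact_mod_cast h
    nlinarith [Real.pi_le_four, mul_le_mul_of_nonneg_right h1 (by linarith : (0 : ℝ) ≤ n)]

theorem isBigO_sub_sqrt :
    (fun n : ℕ => (((n : ℝ) - 1) - (n : ℝ) * ramanujanP n / ((n : ℝ) - 1)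
          + (ramanujanP (n - 1) + 1) / ((n : ℝ) - 1)) - ((n : ℝ) - √(Real.pi * (n : ℝ) / 2)))
        =O[atTop] (fun _ : ℕ => (1 : ℝ)) := by
  refine IsBigO.of_bound 300 ?_
  filter_upwards [eventually_ge_atTop 2] with n hn
  obtain ⟨m, rfl⟩ : ∃ m, n = m + 1 := ⟨n - 1, by omega⟩
  have hm : (1 : ℝ) ≤ m := by exact_mod_cast (by omega : 1 ≤ m)
  have h1 := abs_le.1 (abs_ramanujanP_sub_sqrt_le (Nat.succ_pos m))
  have h2 := abs_le.1 (abs_ramanujanP_sub_sqrt_le (n := m) (by omega))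
  have h3 := sqrt_pi_mul_div_two_le (m + 1)
  have h4 := sqrt_pi_mul_div_two_le m
  have h5 := Real.sqrt_nonneg (Real.pi * ((m + 1 : ℕ) : ℝ) / 2)
  have h6 := Real.sqrt_nonneg (Real.pi * (m : ℝ) / 2)
  rw [Nat.add_sub_cancel]
  simp only [Nat.succ_eq_add_one] at h1
  set s := √(Real.pi * ((m + 1 : ℕ) : ℝ) / 2)
  set r := √(Real.pi * (m : ℝ) / 2)
  set p := ramanujanP (m + 1)
  set q := ramanujanP m
  have hcast : ((m + 1 : ℕ) : ℝ) = m + 1 := by push_cast; ring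
  rw [hcast] at h3 ⊢
  have hm0 : (m : ℝ) ≠ 0 := by positivity
  have he : (m + 1 : ℝ) - 1 - (m + 1) * p / (m + 1 - 1) + (q + 1) / (m + 1 - 1) - (m + 1 - s)
      = (-1 + (s - p)) + (q + 1 - p) / m := by
    rw [add_sub_cancel_right]
    field_simp
    ring
  -- A linear bound on `p` and `q` is enough here, since the difference is divided by `m`; the sharp
  -- estimate is needed only for `s - p`.
  have hq : |(q + 1 - p) / m| ≤ 200 := by
    rw [abs_div, abs_of_pos (by linarith : (0 : ℝ) < m), div_le_iff₀ (by linarith), abs_le]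
    constructor <;> linarith [h1.1, h1.2, h2.1, h2.2]
  have hq' := abs_le.1 hq
  rw [he, norm_one, mul_one, Real.norm_eq_abs, abs_le]
  constructor <;> linarith [h1.1, h1.2, hq'.1, hq'.2]

end BubbleSort

theorem mainTheorem8 :
    (fun n : ℕ => BubbleSort.averageLeafHeight n - ((n : ℝ) - √(Real.pi * (n : ℝ) / 2)))
        =O[atTop] (fun _ : ℕ => (1 : ℝ)) ∧
    (∀ n : ℕ, 2 ≤ n →
      BubbleSort.averageLeafHeight n = BubbleSort.averagePassesOffImage n) ∧
    (∀ n : ℕ, 2 ≤ n →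
      BubbleSort.averageLeafHeight n =
        ((n : ℝ) - 1) - (n : ℝ) * BubbleSort.ramanujanP n / ((n : ℝ) - 1)
          + (BubbleSort.ramanujanP (n - 1) + 1) / ((n : ℝ) - 1)) := by
  refine ⟨?_, fun n hn => BubbleSort.averageLeafHeight_eq_averagePassesOffImage hn, fun n hn => ?_⟩
  · refine BubbleSort.isBigO_sub_sqrt.congr' ?_ EventuallyEq.rfl
    filter_upwards [eventually_ge_atTop 2] with n hn
    rw [BubbleSort.averageLeafHeight_eq_averagePassesOffImage hn,
      BubbleSort.averagePassesOffImage_eq hn]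
  · rw [BubbleSort.averageLeafHeight_eq_averagePassesOffImage hn,
      BubbleSort.averagePassesOffImage_eq hn]
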